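/- Let $k\ge 0$ and $n>k+2$ be integers, put $m=n-2-k$, and let $X$ be a fixed real $n\times(2+k)$ matrix of full column rank, with columns numbered $0,1,\dots,1+k$. (In the application, column $0$ is the constant $1$ and column $1$ is the $0/1$ group indicator; this is not needed for the statement.) Consider the normal linear model $Y=X\beta+\varepsilon$ with unknown $\beta=(\beta_0,\dots,\beta_{1+k})'\in\mathbb R^{2+k}$, unknown $\sigma>0$, and $\varepsilon\sim N_n(0,\sigma^2 I_n)$. The effect size is $d=\beta_1/\sigma$. Put $$\widehat\beta=(X'X)^{-1}X'Y,\quad \widehat\sigma^2=\tfrac1m (Y-X\widehat\beta)'(Y-X\widehat\beta),\quad \widehat d=\frac{\widehat\beta_1}{\sqrt{\widehat\sigma^2}},\quad v_1^2=e'(X'X)^{-1}e,$$ where $e\in\mathbb R^{2+k}$ is the unit vector at the position of $\beta_1$. Let $t(m,\tau)$ denote the non-central $t$ distribution with $m$ degrees of freedom and non-centrality parameter $\tau\in\mathbb R$, that is, the law of $Z/\sqrt{V/m}$ for independent $Z\sim N(\tau,1)$ and $V\sim\chi^2_m$. Let $F(\tau)$ be the value of the cumulative distribution function of $t(m,\tau)$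 at the observed $\widehat d/\sqrt{v_1^2}$, considered as a function of $\tau$. Let $0<\alpha<1$. Then, for any observed data with $\widehat\sigma^2>0$ (which holds with probability one), each of the equations $F(\tau_1)=1-\alpha/2$ and $F(\tau_2)=\alpha/2$ has exactly one real solution, and with these solutions the interval $$\left[\tau_1\sqrt{v_1^2},\ \tau_2\sqrt{v_1^2}\right]$$ is a $(1-\alpha)$ confidence interval for $d$: for every $\beta\in\mathbb R^{2+k}$ and every $\sigma>0$, $$\Pr\left(\tau_1\sqrt{v_1^2}\le d\le \tau_2\sqrt{v_1^2}\right)=1-\alpha .$$ -/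

import Mathlib

open MeasureTheory ProbabilityTheory
open scoped Matrix

noncomputable section

namespace CohenD

/-- The central chi-squared distribution with `m` degrees of freedom: the law of
`Z₁² + ⋯ + Zₘ²` for independent standard normal variables `Z₁, …, Zₘ`. -/
def chiSquared (m : ℕ) : Measure ℝ :=
  (Measure.pi fun _ : Fin m => gaussianReal 0 1).map fun z => ∑ i, z i ^ 2

/-- The non-central `t` distribution `t(m, τ)` with `m` degrees of freedom and non-centrality
parameter `τ`: the law of `Z / √(V / m)` for independent `Z ∼ N(τ, 1)` and `V ∼ χ²(m)`. -/
def noncentralT (m : ℕ) (τ : ℝ) : Measure ℝ :=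
  ((gaussianReal τ 1).prod (chiSquared m)).map fun p => p.1 / √(p.2 / m)

instance isProbabilityMeasure_chiSquared (m : ℕ) : IsProbabilityMeasure (chiSquared m) := by
  unfold chiSquared
  have h : Measurable fun z : Fin m → ℝ => ∑ i, z i ^ 2 := by fun_prop
  exact Measure.isProbabilityMeasure_map h.aemeasurable

instance isProbabilityMeasure_noncentralT (m : ℕ) (τ : ℝ) :
    IsProbabilityMeasure (noncentralT m τ) := by
  unfold noncentralT
  exact Measure.isProbabilityMeasure_map (by fun_prop)

variable {n k : ℕ}

/-- Residual degrees of freedom `m = n - 2 - k` (used only for `k + 2 < n`). -/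
def dof (n k : ℕ) : ℕ := n - 2 - k

/-- Least squares estimator `(X'X)⁻¹ X' y`. -/
def betaHat (X : Matrix (Fin n) (Fin (k + 2)) ℝ) (y : Fin n → ℝ) : Fin (k + 2) → ℝ :=
  (Xᵀ * X)⁻¹ *ᵥ (Xᵀ *ᵥ y)

/-- The usual unbiased variance estimator `m⁻¹ (y - X β̂)'(y - X β̂)`. -/
def sigmaHatSq (X : Matrix (Fin n) (Fin (k + 2)) ℝ) (y : Fin n → ℝ) : ℝ :=
  (dof n k : ℝ)⁻¹ * ((y - X *ᵥ betaHat X y) ⬝ᵥ (y - X *ᵥ betaHat X y))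

/-- Generalized Cohen's estimator `β̂₁ / √σ̂²`; coordinates are numbered `0, 1, …, k + 1`. -/
def dHat (X : Matrix (Fin n) (Fin (k + 2)) ℝ) (y : Fin n → ℝ) : ℝ :=
  betaHat X y 1 / √(sigmaHatSq X y)

/-- `v₁² = e' (X'X)⁻¹ e`, where `e` is the unit vector at the position of `β₁`. -/
def vOneSq (X : Matrix (Fin n) (Fin (k + 2)) ℝ) : ℝ :=
  (Xᵀ * X)⁻¹ 1 1

/-- The population effect size `d = β₁ / σ`. -/
def effectSize (β : Fin (k + 2) → ℝ) (σ : ℝ) : ℝ := β 1 / σ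

/-- `F(τ)` for the data `y`: the cumulative distribution function of `t(m, τ)` at the observed
value `d̂ / √(v₁²)`, as a function of `τ`. -/
def obsCDF (X : Matrix (Fin n) (Fin (k + 2)) ℝ) (y : Fin n → ℝ) (τ : ℝ) : ℝ :=
  cdf (noncentralT (dof n k) τ) (dHat X y / √(vOneSq X))

end CohenD

end

/-! Write `v = √(v₁²)`, `T = d̂ / v`, `δ = d / v`, and let `G(τ, x)` be the distribution function of
`t(m, τ)` at `x`. The proof inverts the pivot `G(δ, T)`.

Conditioning on `V` gives `G(τ, x) = E Φ(x √(V/m) - τ)`. So `G` is continuous in each variable,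
strictly increasing in `x`, and strictly decreasing in `τ` from 1 to 0 (`cdf_noncentralT`,
`integral_mixtureCDF_lt`); hence the solutions exist and are unique.

Geometry gives `T ∼ t(m, δ)`: `β̂₁` sees the noise only along a direction in the column space, `σ̂²`
only its components orthogonal to that space (`exists_map_eq_prod_chiSquared`).

Finally `τ₁ ≤ δ` iff `G(δ, T) ≤ 1 - α/2`, and `δ ≤ τ₂` iff `α/2 ≤ G(δ, T)`. Coverage thus means that
`T` lies between two quantiles of its own law. -/

namespace CohenD

open Set Filter Topology

/-! ### Monotonicity, continuity and limits of the non-central t distribution function -/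

section CDF

/-- The cumulative distribution function of the standard normal distribution. -/
noncomputable def stdNormalCDF (x : ℝ) : ℝ := (gaussianReal 0 1).real (Iic x)

instance nullSingletonClass_gaussianReal_one (τ : ℝ) : NullSingletonClass (gaussianReal τ 1) :=
  nullSingletonClass_gaussianReal one_ne_zero

lemma stdNormalCDF_eq_cdf : stdNormalCDF = cdf (gaussianReal 0 1) := by
  ext x
  rw [stdNormalCDF, cdf_eq_real]

lemma stdNormalCDF_nonneg (x : ℝ) : 0 ≤ stdNormalCDF x := measureReal_nonneg

lemma stdNormalCDF_le_one (x : ℝ) : stdNormalCDF x ≤ 1 := measureReal_le_one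

lemma strictMono_stdNormalCDF : StrictMono stdNormalCDF := by
  intro a b hab
  have hpos : 0 < (gaussianReal 0 1).real (Ioc a b) := by
    refine ENNReal.toReal_pos (fun h => ?_) (measure_ne_top _ _)
    have := gaussianReal_absolutelyContinuous' 0 (one_ne_zero (α := NNReal)) h
    simp at this
    linarith
  have hunion : (gaussianReal 0 1).real (Iic b) =
      (gaussianReal 0 1).real (Iic a) + (gaussianReal 0 1).real (Ioc a b) := by
    rw [← measureReal_union _ measurableSet_Ioc, Iic_union_Ioc_eq_Iic hab.le]
    exact (Set.Iic_disjoint_Ioc le_rfl)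
  unfold stdNormalCDF
  linarith

/-- A distribution function is right-continuous, and its jump at a point is the mass there, which is
zero for a Gaussian. -/
lemma continuous_stdNormalCDF : Continuous stdNormalCDF := by
  rw [stdNormalCDF_eq_cdf, continuous_iff_continuousAt]
  intro x
  rw [(monotone_cdf _).continuousAt_iff_leftLim_eq_rightLim, StieltjesFunction.rightLim_eq]
  have h : (cdf (gaussianReal 0 1)).measure {x} = 0 := by rw [measure_cdf]; simp
  rw [StieltjesFunction.measure_singleton, ENNReal.ofReal_eq_zero] at h
  exact le_antisymm ((monotone_cdf _).leftLim_le le_rfl) (by linarith)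

lemma tendsto_stdNormalCDF_atTop : Tendsto stdNormalCDF atTop (𝓝 1) := by
  rw [stdNormalCDF_eq_cdf]; exact tendsto_cdf_atTop _

lemma tendsto_stdNormalCDF_atBot : Tendsto stdNormalCDF atBot (𝓝 0) := by
  rw [stdNormalCDF_eq_cdf]; exact tendsto_cdf_atBot _

lemma gaussianReal_Iic (τ a : ℝ) : (gaussianReal τ 1) (Iic a) =
    ENNReal.ofReal (stdNormalCDF (a - τ)) := by
  rw [stdNormalCDF, ofReal_measureReal, ← zero_add τ, ← gaussianReal_map_add_const,
    Measure.map_apply (by fun_prop) measurableSet_Iic]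
  congr 1
  ext x
  simp [le_sub_iff_add_le]

lemma ae_pos_chiSquared {m : ℕ} (hm : m ≠ 0) : ∀ᵐ v ∂chiSquared m, 0 < v := by
  have hmeas : Measurable fun z : Fin m → ℝ => ∑ i, z i ^ 2 := by fun_prop
  rw [chiSquared, ae_map_iff hmeas.aemeasurable measurableSet_Ioi]
  obtain ⟨i⟩ : Nonempty (Fin m) := ⟨⟨0, Nat.pos_of_ne_zero hm⟩⟩
  have h : ∀ᵐ x ∂gaussianReal 0 1, x ≠ 0 := by
    rw [ae_iff]; simp
  have h' := (measurePreserving_eval (fun _ : Fin m => gaussianReal 0 1) i).quasiMeasurePreserving.ae h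
  filter_upwards [h'] with z hz
  exact Finset.sum_pos' (fun j _ => sq_nonneg _) ⟨i, Finset.mem_univ _, by positivity⟩

/-- The integrand in the mixture representation of the non-central `t` distribution function. -/
noncomputable def mixtureCDF (m : ℕ) (τ x v : ℝ) : ℝ := stdNormalCDF (x * √(v / m) - τ)

lemma continuous_mixtureCDF (m : ℕ) (τ x : ℝ) : Continuous (mixtureCDF m τ x) :=
  continuous_stdNormalCDF.comp (by fun_prop)

lemma norm_mixtureCDF_le (m : ℕ) (τ x v : ℝ) : ‖mixtureCDF m τ x v‖ ≤ 1 := by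
  rw [mixtureCDF, Real.norm_of_nonneg (stdNormalCDF_nonneg _)]
  exact stdNormalCDF_le_one _

lemma integrable_mixtureCDF (m : ℕ) (τ x : ℝ) : Integrable (mixtureCDF m τ x) (chiSquared m) :=
  Integrable.of_bound (continuous_mixtureCDF m τ x).aestronglyMeasurable 1
    (ae_of_all _ fun v => norm_mixtureCDF_le m τ x v)

lemma sqrt_div_natCast_pos {m : ℕ} (hm : m ≠ 0) {v : ℝ} (hv : 0 < v) : 0 < √(v / m) := by
  have : (0 : ℝ) < m := by positivity
  positivity

/-- Fubini, integrating over `Z` first: for `v > 0`, which is almost sure because `m ≠ 0`, the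
condition `z / √(v/m) ≤ x` is a half-line in `z`. -/
lemma cdf_noncentralT {m : ℕ} (hm : m ≠ 0) (τ x : ℝ) :
    cdf (noncentralT m τ) x = ∫ v, mixtureCDF m τ x v ∂chiSquared m := by
  have hmeas : Measurable fun p : ℝ × ℝ => p.1 / √(p.2 / m) := by fun_prop
  rw [cdf_eq_real, measureReal_def, noncentralT, Measure.map_apply hmeas measurableSet_Iic,
    Measure.prod_apply_symm (hmeas measurableSet_Iic),
    integral_eq_lintegral_of_nonneg_ae (f := mixtureCDF m τ x)
      (ae_of_all _ fun v => stdNormalCDF_nonneg _)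
      (continuous_mixtureCDF m τ x).aestronglyMeasurable]
  congr 1
  refine lintegral_congr_ae ?_
  filter_upwards [ae_pos_chiSquared hm] with v hv
  rw [mixtureCDF, ← gaussianReal_Iic]
  congr 1
  ext z
  exact div_le_iff₀ (sqrt_div_natCast_pos hm hv)

lemma tendsto_integral_mixtureCDF {ι : Type*} {l : Filter ι} [l.IsCountablyGenerated] {m : ℕ}
    {τ x : ι → ℝ} {c : ℝ → ℝ}
    (h : ∀ v, Tendsto (fun i => mixtureCDF m (τ i) (x i) v) l (𝓝 (c v))) :
    Tendsto (fun i => ∫ v, mixtureCDF m (τ i) (x i) v ∂chiSquared m) l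
      (𝓝 (∫ v, c v ∂chiSquared m)) :=
  tendsto_integral_filter_of_dominated_convergence (fun _ => 1)
    (Eventually.of_forall fun i => (continuous_mixtureCDF m (τ i) (x i)).aestronglyMeasurable)
    (Eventually.of_forall fun i => ae_of_all _ fun v => norm_mixtureCDF_le m (τ i) (x i) v)
    (integrable_const _) (ae_of_all _ h)

/-- The difference of the integrands is positive almost everywhere, so its support has full measure.
Only `v > 0` is asked, since at `v = 0` the integrand does not depend on `x`. -/
lemma integral_mixtureCDF_lt {m : ℕ} (hm : m ≠ 0) {τ τ' x x' : ℝ}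
    (h : ∀ v, 0 < v → mixtureCDF m τ x v < mixtureCDF m τ' x' v) :
    ∫ v, mixtureCDF m τ x v ∂chiSquared m < ∫ v, mixtureCDF m τ' x' v ∂chiSquared m := by
  rw [← sub_pos, ← integral_sub (integrable_mixtureCDF _ _ _) (integrable_mixtureCDF _ _ _)]
  have hpos : ∀ᵐ v ∂chiSquared m, 0 < mixtureCDF m τ' x' v - mixtureCDF m τ x v := by
    filter_upwards [ae_pos_chiSquared hm] with v hv using sub_pos.2 (h v hv)
  rw [integral_pos_iff_support_of_nonneg_ae (hpos.mono fun v hv => hv.le)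
    ((integrable_mixtureCDF _ _ _).sub (integrable_mixtureCDF _ _ _))]
  have : Function.support (fun v => mixtureCDF m τ' x' v - mixtureCDF m τ x v)
      =ᵐ[chiSquared m] (univ : Set ℝ) := by
    filter_upwards [hpos] with v hv
    exact eq_true hv.ne'
  rw [measure_congr this]
  simp

lemma strictMono_cdf_noncentralT {m : ℕ} (hm : m ≠ 0) (τ : ℝ) :
    StrictMono (cdf (noncentralT m τ)) := by
  intro x x' hx
  rw [cdf_noncentralT hm, cdf_noncentralT hm]
  refine integral_mixtureCDF_lt hm fun v hv => strictMono_stdNormalCDF ?_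
  have := sqrt_div_natCast_pos hm hv
  gcongr

lemma continuous_cdf_noncentralT {m : ℕ} (hm : m ≠ 0) (τ : ℝ) :
    Continuous (cdf (noncentralT m τ)) := by
  rw [continuous_iff_continuousAt]
  intro x
  rw [ContinuousAt, funext (cdf_noncentralT hm τ)]
  refine tendsto_integral_mixtureCDF (l := 𝓝 x) (τ := fun _ => τ) (x := id) fun v => ?_
  have : Continuous fun x => mixtureCDF m τ x v := continuous_stdNormalCDF.comp (by fun_prop)
  exact this.tendsto x

lemma strictAnti_cdf_noncentralT {m : ℕ} (hm : m ≠ 0) (x : ℝ) :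
    StrictAnti fun τ => cdf (noncentralT m τ) x := by
  intro τ τ' hτ
  simp only [cdf_noncentralT hm]
  exact integral_mixtureCDF_lt hm fun v _ => strictMono_stdNormalCDF (by gcongr)

lemma continuous_cdf_noncentralT_noncentrality {m : ℕ} (hm : m ≠ 0) (x : ℝ) :
    Continuous fun τ => cdf (noncentralT m τ) x := by
  rw [continuous_iff_continuousAt]
  intro τ
  simp_rw [ContinuousAt, cdf_noncentralT hm]
  refine tendsto_integral_mixtureCDF (l := 𝓝 τ) (τ := id) (x := fun _ => x) fun v => ?_
  have : Continuous fun τ => mixtureCDF m τ x v := continuous_stdNormalCDF.comp (by fun_prop)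
  exact this.tendsto τ

lemma tendsto_cdf_noncentralT_atTop {m : ℕ} (hm : m ≠ 0) (x : ℝ) :
    Tendsto (fun τ => cdf (noncentralT m τ) x) atTop (𝓝 0) := by
  simp_rw [cdf_noncentralT hm]
  have h : ∀ v, Tendsto (fun τ => mixtureCDF m τ x v) atTop (𝓝 0) := fun v =>
    tendsto_stdNormalCDF_atBot.comp
      ((tendsto_atBot_add_const_left atTop (x * √(v / m)) tendsto_neg_atTop_atBot).congr
        fun τ => (sub_eq_add_neg _ τ).symm)
  simpa using tendsto_integral_mixtureCDF (m := m) (τ := id) (x := fun _ => x) h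

lemma tendsto_cdf_noncentralT_atBot {m : ℕ} (hm : m ≠ 0) (x : ℝ) :
    Tendsto (fun τ => cdf (noncentralT m τ) x) atBot (𝓝 1) := by
  simp_rw [cdf_noncentralT hm]
  have h : ∀ v, Tendsto (fun τ => mixtureCDF m τ x v) atBot (𝓝 1) := fun v =>
    tendsto_stdNormalCDF_atTop.comp
      ((tendsto_atTop_add_const_left atBot (x * √(v / m)) tendsto_neg_atBot_atTop).congr
        fun τ => (sub_eq_add_neg _ τ).symm)
  simpa using tendsto_integral_mixtureCDF (m := m) (τ := id) (x := fun _ => x) h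

lemma existsUnique_cdf_noncentralT_eq {m : ℕ} (hm : m ≠ 0) (x : ℝ) {p : ℝ} (hp : p ∈ Ioo 0 1) :
    ∃! τ, cdf (noncentralT m τ) x = p := by
  refine existsUnique_of_exists_of_unique ?_ fun τ τ' h h' =>
    (strictAnti_cdf_noncentralT hm x).injective (h.trans h'.symm)
  exact mem_range_of_exists_le_of_exists_ge (continuous_cdf_noncentralT_noncentrality hm x)
    ((tendsto_cdf_noncentralT_atTop hm x).eventually_le_const hp.1).exists
    ((tendsto_cdf_noncentralT_atBot hm x).eventually_const_le hp.2).exists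

lemma exists_cdf_noncentralT_quantile {m : ℕ} (hm : m ≠ 0) (τ : ℝ) {p : ℝ} (hp : p ∈ Ioo 0 1) :
    ∃ q, cdf (noncentralT m τ) q = p :=
  mem_range_of_exists_le_of_exists_ge (continuous_cdf_noncentralT hm τ)
    ((tendsto_cdf_atBot _).eventually_le_const hp.1).exists
    ((tendsto_cdf_atTop _).eventually_const_le hp.2).exists

lemma noncentralT_Icc {m : ℕ} (hm : m ≠ 0) (τ a b : ℝ) :
    noncentralT m τ (Icc a b) =
      ENNReal.ofReal (cdf (noncentralT m τ) b - cdf (noncentralT m τ) a) := by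
  conv_lhs => rw [← measure_cdf (noncentralT m τ)]
  rw [StieltjesFunction.measure_Icc,
    (continuous_cdf_noncentralT hm τ).continuousAt.continuousWithinAt.leftLim_eq]

end CDF

end CohenD

namespace CohenD

/-! ### Orthonormal coordinates of an isotropic normal vector -/

section GaussianCoordinates

variable {ι κ : Type*} [Fintype ι] [Fintype κ] [DecidableEq ι]

open scoped RealInnerProductSpace

/-- Rescaled coordinates of an isotropic normal vector along an orthonormal family are independent
standard normal variables. -/
lemma map_inner_orthonormal_multivariateGaussian {v : κ → EuclideanSpace ℝ ι}
    (hv : Orthonormal ℝ v) {σ : ℝ} (hσ : σ ≠ 0) :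
    (multivariateGaussian 0 (σ ^ 2 • (1 : Matrix ι ι ℝ))).map (fun x i => σ⁻¹ * ⟪v i, x⟫) =
      Measure.pi fun _ : κ => gaussianReal 0 1 := by
  have hlin : (multivariateGaussian 0 (σ ^ 2 • (1 : Matrix ι ι ℝ))).map
      (fun x => WithLp.toLp 2 fun i => σ⁻¹ * ⟪v i, x⟫) = stdGaussian (EuclideanSpace ℝ κ) := by
    -- The characteristic function of the image at `t` is the original one at `σ⁻¹ ∑ tᵢ vᵢ`, a
    -- vector of norm `‖t‖ / |σ|` by orthonormality; the variance `σ²` cancels the scale.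
    apply Measure.ext_of_charFun
    ext t
    have hnorm : ‖∑ i, t i • v i‖ ^ 2 = ‖t‖ ^ 2 := by
      rw [← real_inner_self_eq_norm_sq, hv.inner_sum, EuclideanSpace.real_norm_sq_eq]
      simp [sq]
    have hS : (σ ^ 2 • (1 : Matrix ι ι ℝ)).PosSemidef := Matrix.PosSemidef.one.smul (sq_nonneg σ)
    have hchar : charFun ((multivariateGaussian 0 (σ ^ 2 • (1 : Matrix ι ι ℝ))).map
        (fun x => WithLp.toLp 2 fun i => σ⁻¹ * ⟪v i, x⟫)) t =
        charFun (multivariateGaussian 0 (σ ^ 2 • (1 : Matrix ι ι ℝ)))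
          (σ⁻¹ • ∑ i, t i • v i) := by
      rw [charFun_apply, charFun_apply, integral_map (Measurable.aemeasurable (by fun_prop))
        (Measurable.aestronglyMeasurable (by fun_prop))]
      congr 1
      ext x
      congr 3
      simp only [PiLp.inner_apply (𝕜 := ℝ) (x := WithLp.toLp 2 fun i => σ⁻¹ * ⟪v i, x⟫),
        inner_smul_right, inner_sum, Finset.mul_sum, real_inner_comm (v _) x]
      refine Finset.sum_congr rfl fun i _ => ?_
      simp
      ring
    rw [hchar, charFun_multivariateGaussian hS, charFun_stdGaussian, ← Complex.ofReal_pow ‖t‖,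
      ← hnorm]
    set w := ∑ i, t i • v i
    have hw : (σ⁻¹ • w).ofLp ⬝ᵥ (σ ^ 2 • (1 : Matrix ι ι ℝ)) *ᵥ (σ⁻¹ • w).ofLp = ‖w‖ ^ 2 := by
      rw [EuclideanSpace.real_norm_sq_eq, Matrix.smul_mulVec, Matrix.one_mulVec]
      simp only [dotProduct, WithLp.ofLp_smul, Pi.smul_apply, smul_eq_mul]
      refine Finset.sum_congr rfl fun i _ => ?_
      field_simp
    rw [hw]
    simp [neg_div]
  rw [← map_pi_eq_stdGaussian] at hlin
  have h := congrArg (Measure.map (WithLp.ofLp : EuclideanSpace ℝ κ → κ → ℝ)) hlin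
  rw [Measure.map_map (by fun_prop) (by fun_prop), Measure.map_map (by fun_prop) (by fun_prop)] at h
  simpa [Function.comp_def] using! h

/-- For an orthonormal family `u, w₁, …, wₘ`, the coordinate along `u` and the sum of squares of
the others are independent standard normal and chi-squared variables. -/
lemma map_inner_sum_sq_multivariateGaussian {m : ℕ} {v : Fin (m + 1) → EuclideanSpace ℝ ι}
    (hv : Orthonormal ℝ v) {σ : ℝ} (hσ : σ ≠ 0) :
    (multivariateGaussian 0 (σ ^ 2 • (1 : Matrix ι ι ℝ))).map
      (fun x => (σ⁻¹ * ⟪v 0, x⟫, ∑ i : Fin m, (σ⁻¹ * ⟪v i.succ, x⟫) ^ 2)) =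
      (gaussianReal 0 1).prod (chiSquared m) := by
  have h1 := (measurePreserving_piFinSuccAbove (fun _ : Fin (m + 1) => gaussianReal 0 1) 0).map_eq
  have h2 := congrArg (Measure.map (Prod.map id fun z : Fin m → ℝ => ∑ i, z i ^ 2)) h1
  rw [← Measure.map_prod_map _ _ measurable_id (by fun_prop), Measure.map_id,
    ← map_inner_orthonormal_multivariateGaussian hv hσ,
    Measure.map_map (by fun_prop) (by fun_prop), Measure.map_map (by fun_prop) (by fun_prop)] at h2
  rw [chiSquared, ← h2]
  rfl

end GaussianCoordinates

/-! ### Geometry of least squares -/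

section LeastSquares

variable {n k : ℕ} {X : Matrix (Fin n) (Fin (k + 2)) ℝ}

open scoped RealInnerProductSpace

lemma isUnit_det_gram (hX : X.rank = k + 2) : IsUnit (Xᵀ * X).det := by
  rw [← Matrix.isUnit_iff_isUnit_det, ← Matrix.linearIndependent_cols_iff_isUnit,
    linearIndependent_iff_card_eq_finrank_span, Set.finrank, ← Matrix.rank_eq_finrank_span_cols,
    Matrix.rank_transpose_mul_self, hX, Fintype.card_fin]

lemma posDef_gram_inv (hX : X.rank = k + 2) : ((Xᵀ * X)⁻¹).PosDef := by
  refine Matrix.PosDef.inv ?_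
  have h : (Xᵀ * X).PosSemidef := by
    simpa using Matrix.posSemidef_conjTranspose_mul_self X
  exact h.posDef_iff_isUnit.2 ((Matrix.isUnit_iff_isUnit_det _).2 (isUnit_det_gram hX))

lemma vOneSq_pos (hX : X.rank = k + 2) : 0 < vOneSq X :=
  (posDef_gram_inv hX).diag_pos

/-- The coefficient vector of the linear form `y ↦ β̂₁`. -/
noncomputable def betaHatCoeff (X : Matrix (Fin n) (Fin (k + 2)) ℝ) : Fin n → ℝ :=
  X *ᵥ (Xᵀ * X)⁻¹.col 1

lemma betaHat_add (hX : X.rank = k + 2) (β : Fin (k + 2) → ℝ) (e : Fin n → ℝ) :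
    betaHat X (X *ᵥ β + e) = β + betaHat X e := by
  rw [betaHat, betaHat, Matrix.mulVec_add, Matrix.mulVec_add, Matrix.mulVec_mulVec,
    Matrix.mulVec_mulVec, Matrix.mul_assoc, Matrix.nonsing_inv_mul _ (isUnit_det_gram hX), Matrix.one_mulVec]

lemma gram_inv_symm : ((Xᵀ * X)⁻¹)ᵀ = (Xᵀ * X)⁻¹ := by
  rw [Matrix.transpose_nonsing_inv]; simp

lemma betaHat_one (e : Fin n → ℝ) : betaHat X e 1 = betaHatCoeff X ⬝ᵥ e := by
  rw [betaHat, betaHatCoeff, Matrix.mulVec, Matrix.dotProduct_mulVec, ← Matrix.mulVec_transpose,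
    Matrix.transpose_transpose]
  congr 2
  conv_rhs => rw [← gram_inv_symm]
  rfl

/-- The form `β̂₁` is evaluated at its own coefficient vector `X (X'X)⁻¹ e`; this lies in the column
space, where `β̂` recovers the coefficients `(X'X)⁻¹ e`. -/
lemma betaHatCoeff_dotProduct_self (hX : X.rank = k + 2) :
    betaHatCoeff X ⬝ᵥ betaHatCoeff X = vOneSq X := by
  rw [← betaHat_one, betaHat, betaHatCoeff, Matrix.mulVec_mulVec, Matrix.mulVec_mulVec,
    Matrix.mul_assoc, Matrix.nonsing_inv_mul _ (isUnit_det_gram hX), Matrix.one_mulVec]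
  rfl

lemma transpose_mulVec_residual (hX : X.rank = k + 2) (y : Fin n → ℝ) :
    Xᵀ *ᵥ (y - X *ᵥ betaHat X y) = 0 := by
  rw [Matrix.mulVec_sub, betaHat, Matrix.mulVec_mulVec, Matrix.mulVec_mulVec,
    Matrix.mul_nonsing_inv _ (isUnit_det_gram hX), Matrix.one_mulVec, sub_self]

lemma residual_add (hX : X.rank = k + 2) (β : Fin (k + 2) → ℝ) (e : Fin n → ℝ) :
    X *ᵥ β + e - X *ᵥ betaHat X (X *ᵥ β + e) = e - X *ᵥ betaHat X e := by
  rw [betaHat_add hX, Matrix.mulVec_add]; abel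

/-- An orthonormal basis of the orthogonal complement of the column space. -/
lemma exists_orthonormal_residual_space (hX : X.rank = k + 2) :
    ∃ w : Fin (dof n k) → EuclideanSpace ℝ (Fin n), Orthonormal ℝ w ∧
      (∀ j b, ⟪w j, WithLp.toLp 2 (X *ᵥ b)⟫ = 0) ∧
      ∀ r : Fin n → ℝ, Xᵀ *ᵥ r = 0 → r ⬝ᵥ r = ∑ j, ⟪w j, WithLp.toLp 2 r⟫ ^ 2 := by
  let L : (Fin (k + 2) → ℝ) →ₗ[ℝ] EuclideanSpace ℝ (Fin n) :=
    (WithLp.linearEquiv 2 ℝ (Fin n → ℝ)).symm.toLinearMap ∘ₗ X.mulVecLin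
  let S := LinearMap.range L
  have hS : Module.finrank ℝ S = k + 2 := by
    rw [← hX, Matrix.rank, ← LinearEquiv.finrank_map_eq (WithLp.linearEquiv 2 ℝ (Fin n → ℝ)).symm,
      ← LinearMap.range_comp]
  have hSo : Module.finrank ℝ Sᗮ = dof n k := by
    have := S.finrank_add_finrank_orthogonal
    rw [hS, finrank_euclideanSpace_fin] at this
    unfold dof; omega
  let b : OrthonormalBasis (Fin (dof n k)) ℝ Sᗮ :=
    (stdOrthonormalBasis ℝ Sᗮ).reindex (finCongr hSo)
  refine ⟨fun j => b j, b.orthonormal.comp_linearIsometry Sᗮ.subtypeₗᵢ, fun j c => ?_,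
    fun r hr => ?_⟩
  · exact (Submodule.mem_orthogonal' S _).1 (b j).2 _ ⟨c, rfl⟩
  · have hrS : WithLp.toLp 2 r ∈ Sᗮ := by
      rw [Submodule.mem_orthogonal']
      rintro _ ⟨c, rfl⟩
      have : (X *ᵥ c) ⬝ᵥ r = 0 := by
        rw [dotProduct_comm, Matrix.dotProduct_mulVec, ← Matrix.mulVec_transpose, hr,
          zero_dotProduct]
      simpa [EuclideanSpace.inner_eq_star_dotProduct, L] using! this
    -- Parseval in the orthogonal complement.
    have h := b.sum_sq_inner_right ⟨_, hrS⟩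
    simp only [Submodule.coe_inner] at h
    rw [h, Submodule.coe_norm, EuclideanSpace.real_norm_sq_eq]
    simp [dotProduct, sq]

/-- The joint sampling distribution of `β̂₁` and `σ̂²` in the normal linear model. -/
lemma exists_map_eq_prod_chiSquared (hn : k + 2 < n) (hX : X.rank = k + 2)
    {σ : ℝ} (hσ : 0 < σ) :
    ∃ g : EuclideanSpace ℝ (Fin n) → ℝ × ℝ, Measurable g ∧
      (multivariateGaussian 0 (σ ^ 2 • (1 : Matrix (Fin n) (Fin n) ℝ))).map g =
        (gaussianReal 0 1).prod (chiSquared (dof n k)) ∧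
      ∀ (β : Fin (k + 2) → ℝ) (e : EuclideanSpace ℝ (Fin n)),
        betaHat X (X *ᵥ β + e.ofLp) 1 = β 1 + σ * √(vOneSq X) * (g e).1 ∧
        sigmaHatSq X (X *ᵥ β + e.ofLp) = σ ^ 2 * ((g e).2 / dof n k) := by
  obtain ⟨w, hw, hwX, hwr⟩ := exists_orthonormal_residual_space hX
  have hv : 0 < √(vOneSq X) := Real.sqrt_pos.2 (vOneSq_pos hX)
  let u : EuclideanSpace ℝ (Fin n) := (√(vOneSq X))⁻¹ • WithLp.toLp 2 (betaHatCoeff X)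
  have hnorm : ‖u‖ = 1 := by
    have h : ‖WithLp.toLp 2 (betaHatCoeff X)‖ ^ 2 = vOneSq X := by
      rw [← betaHatCoeff_dotProduct_self hX, EuclideanSpace.real_norm_sq_eq]
      simp [dotProduct, sq]
    rw [norm_smul, ← Real.sqrt_sq (norm_nonneg (WithLp.toLp 2 (betaHatCoeff X))), h,
      Real.norm_of_nonneg (inv_nonneg.2 hv.le), inv_mul_cancel₀ hv.ne']
  -- `u` lies in the column space, so the whole family `u, w` is orthonormal.
  have hwu : ∀ j, ⟪w j, u⟫ = 0 := fun j => by
    rw [inner_smul_right, betaHatCoeff, hwX, mul_zero]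
  let v : Fin (dof n k + 1) → EuclideanSpace ℝ (Fin n) := Fin.cons u w
  have hvo : Orthonormal ℝ v := by
    refine ⟨Fin.cases hnorm hw.1, ?_⟩
    intro i
    refine Fin.cases ?_ (fun i => ?_) i <;> intro j <;> refine Fin.cases ?_ (fun j => ?_) j
    · intro h; exact absurd rfl h
    · intro _; simpa [v, real_inner_comm] using hwu j
    · intro _; simpa [v] using hwu i
    · intro h; simpa [v] using hw.2 (fun h' => h (congrArg Fin.succ h'))
  refine ⟨_, by fun_prop, map_inner_sum_sq_multivariateGaussian hvo hσ.ne', fun β e => ⟨?_, ?_⟩⟩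
  · have : ⟪u, e⟫ = (√(vOneSq X))⁻¹ * (betaHatCoeff X ⬝ᵥ e.ofLp) := by
      rw [inner_smul_left, EuclideanSpace.inner_eq_star_dotProduct, dotProduct_comm]
      simp
    rw [betaHat_add hX, Pi.add_apply, betaHat_one]
    simp only [v, Fin.cons_zero, this]
    field_simp
  · rw [sigmaHatSq, residual_add hX, hwr _ (transpose_mulVec_residual hX _)]
    -- Noise and residual differ by a vector of the column space, invisible to `w`.
    have : ∀ j, ⟪w j, WithLp.toLp 2 (e.ofLp - X *ᵥ betaHat X e.ofLp)⟫ = ⟪w j, e⟫ := fun j => by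
      rw [WithLp.toLp_sub, inner_sub_right, hwX, sub_zero]
    simp only [this, v, Fin.cons_succ, mul_pow, ← Finset.mul_sum]
    have : (dof n k : ℝ) ≠ 0 := by unfold dof; exact_mod_cast (by omega)
    field_simp

end LeastSquares

end CohenD

namespace CohenD

/-! ### Sampling distribution of the effect size estimator -/

section Inference

open Set

variable {n k : ℕ} {X : Matrix (Fin n) (Fin (k + 2)) ℝ}

lemma dof_ne_zero (hn : k + 2 < n) : dof n k ≠ 0 := by
  unfold dof; omega

lemma map_prod_eq_noncentralT (m : ℕ) (τ : ℝ) :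
    ((gaussianReal 0 1).prod (chiSquared m)).map (fun p => (τ + p.1) / √(p.2 / m)) =
      noncentralT m τ := by
  have h := Measure.map_prod_map (gaussianReal 0 1) (chiSquared m)
    (f := (τ + ·)) (g := id) (by fun_prop) measurable_id
  rw [gaussianReal_map_const_add, zero_add, Measure.map_id] at h
  rw [noncentralT, h, Measure.map_map (by fun_prop) (by fun_prop)]
  rfl

/-- In the normal linear model, `σ̂² > 0` almost surely and `d̂ / v₁` has a non-central `t`
distribution. -/
lemma hasLaw_dHat_div_sqrt_vOneSq (hn : k + 2 < n) (hX : X.rank = k + 2) (β : Fin (k + 2) → ℝ)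
    {σ : ℝ} (hσ : 0 < σ) {Ω : Type*} [MeasurableSpace Ω] {P : Measure Ω}
    {ε : Ω → EuclideanSpace ℝ (Fin n)} {Y : Ω → Fin n → ℝ}
    (hε : HasLaw ε (multivariateGaussian 0 (σ ^ 2 • (1 : Matrix (Fin n) (Fin n) ℝ))) P)
    (hY : ∀ ω, Y ω = X *ᵥ β + (ε ω).ofLp) :
    (∀ᵐ ω ∂P, 0 < sigmaHatSq X (Y ω)) ∧
      HasLaw (fun ω => dHat X (Y ω) / √(vOneSq X))
        (noncentralT (dof n k) (effectSize β σ / √(vOneSq X))) P := by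
  obtain ⟨g, hg, hmap, hgY⟩ := exists_map_eq_prod_chiSquared hn hX hσ
  have hv : 0 < √(vOneSq X) := Real.sqrt_pos.2 (vOneSq_pos hX)
  have hm := dof_ne_zero hn
  have hlaw : HasLaw (fun ω => g (ε ω)) ((gaussianReal 0 1).prod (chiSquared (dof n k))) P :=
    HasLaw.fun_comp ⟨hg.aemeasurable, hmap⟩ hε
  constructor
  · have h : ∀ᵐ p ∂(gaussianReal 0 1).prod (chiSquared (dof n k)), 0 < p.2 :=
      Measure.quasiMeasurePreserving_snd.ae (ae_pos_chiSquared hm)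
    have hp : Measurable fun p : ℝ × ℝ => 0 < p.2 :=
      (measurableSet_lt measurable_const measurable_snd).mem
    filter_upwards [(hlaw.ae_iff hp).2 h] with ω hω
    rw [hY, (hgY β (ε ω)).2]
    have : (0 : ℝ) < dof n k := by positivity
    positivity
  · have h := HasLaw.fun_comp ⟨Measurable.aemeasurable (by fun_prop),
      map_prod_eq_noncentralT (dof n k) (effectSize β σ / √(vOneSq X))⟩ hlaw
    refine h.congr (Filter.Eventually.of_forall fun ω => ?_)
    simp only [dHat, effectSize, hY, (hgY β (ε ω)).1, (hgY β (ε ω)).2]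
    rw [Real.sqrt_mul (sq_nonneg σ), Real.sqrt_sq hσ.le]
    field_simp

end Inference

end CohenD

theorem mainTheorem4 {n k : ℕ} (hn : k + 2 < n)
    (X : Matrix (Fin n) (Fin (k + 2)) ℝ) (hX : X.rank = k + 2)
    (α : ℝ) (hα₀ : 0 < α) (hα₁ : α < 1) :
    -- for data with positive variance estimate, both defining equations are uniquely solvable
    (∀ y : Fin n → ℝ, 0 < CohenD.sigmaHatSq X y →
      (∃! τ : ℝ, CohenD.obsCDF X y τ = 1 - α / 2) ∧ (∃! τ : ℝ, CohenD.obsCDF X y τ = α / 2)) ∧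
    -- the solutions, as functions of the data alone, give exact coverage of `d` at all parameters
    ∀ τ₁ τ₂ : (Fin n → ℝ) → ℝ,
      (∀ y, 0 < CohenD.sigmaHatSq X y →
        CohenD.obsCDF X y (τ₁ y) = 1 - α / 2 ∧ CohenD.obsCDF X y (τ₂ y) = α / 2) →
      ∀ (β : Fin (k + 2) → ℝ) (σ : ℝ), 0 < σ →
      ∀ (Ω : Type*) [MeasurableSpace Ω] (P : Measure Ω) [IsProbabilityMeasure P]
        (ε : Ω → EuclideanSpace ℝ (Fin n)) (Y : Ω → Fin n → ℝ),
        HasLaw ε (multivariateGaussian 0 (σ ^ 2 • (1 : Matrix (Fin n) (Fin n) ℝ))) P →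
        (∀ ω, Y ω = X *ᵥ β + (ε ω).ofLp) →
        NullMeasurableSet {ω | CohenD.effectSize β σ ∈
          Set.Icc (τ₁ (Y ω) * √(CohenD.vOneSq X)) (τ₂ (Y ω) * √(CohenD.vOneSq X))} P ∧
        P {ω | CohenD.effectSize β σ ∈
          Set.Icc (τ₁ (Y ω) * √(CohenD.vOneSq X)) (τ₂ (Y ω) * √(CohenD.vOneSq X))} =
          ENNReal.ofReal (1 - α) := by
  have hm := CohenD.dof_ne_zero hn
  have hv : 0 < √(CohenD.vOneSq X) := Real.sqrt_pos.2 (CohenD.vOneSq_pos hX)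
  have hlo : α / 2 ∈ Set.Ioo (0 : ℝ) 1 := ⟨by linarith, by linarith⟩
  have hhi : 1 - α / 2 ∈ Set.Ioo (0 : ℝ) 1 := ⟨by linarith, by linarith⟩
  refine ⟨fun y _ => ⟨CohenD.existsUnique_cdf_noncentralT_eq hm _ hhi,
    CohenD.existsUnique_cdf_noncentralT_eq hm _ hlo⟩, ?_⟩
  intro τ₁ τ₂ hτ β σ hσ Ω _ P _ ε Y hε hY
  obtain ⟨hpos, hT⟩ := CohenD.hasLaw_dHat_div_sqrt_vOneSq hn hX β hσ hε hY
  set δ := CohenD.effectSize β σ / √(CohenD.vOneSq X)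
  obtain ⟨a, ha⟩ := CohenD.exists_cdf_noncentralT_quantile hm δ hlo
  obtain ⟨b, hb⟩ := CohenD.exists_cdf_noncentralT_quantile hm δ hhi
  have hevent : {ω | CohenD.effectSize β σ ∈
      Set.Icc (τ₁ (Y ω) * √(CohenD.vOneSq X)) (τ₂ (Y ω) * √(CohenD.vOneSq X))} =ᵐ[P]
      (fun ω => CohenD.dHat X (Y ω) / √(CohenD.vOneSq X)) ⁻¹' Set.Icc a b := by
    filter_upwards [hpos] with ω hω
    obtain ⟨h₁, h₂⟩ := hτ (Y ω) hω
    refine propext ?_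
    change _ ∈ Set.Icc _ _ ↔ _ ∈ Set.Icc _ _
    -- The endpoints cross: since `G` decreases in `τ`, the bound by `τ₂` matches the lower quantile
    -- `a`, and the bound by `τ₁` the upper quantile `b`.
    rw [Set.mem_Icc, Set.mem_Icc, ← le_div_iff₀ hv, ← div_le_iff₀ hv, and_comm]
    refine and_congr ?_ ?_
    · have h := (CohenD.strictMono_cdf_noncentralT hm δ).le_iff_le (a := a)
        (b := CohenD.dHat X (Y ω) / √(CohenD.vOneSq X))
      rw [ha, ← h₂] at h
      exact (CohenD.strictAnti_cdf_noncentralT hm _).le_iff_ge.symm.trans h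
    · have h := (CohenD.strictMono_cdf_noncentralT hm δ).le_iff_le (b := b)
        (a := CohenD.dHat X (Y ω) / √(CohenD.vOneSq X))
      rw [hb, ← h₁] at h
      exact (CohenD.strictAnti_cdf_noncentralT hm _).le_iff_ge.symm.trans h
  -- `τ₁` and `τ₂` are arbitrary where `σ̂² = 0`, so the event is handled only up to a null set.
  refine ⟨(hT.aemeasurable.nullMeasurableSet_preimage measurableSet_Icc).congr hevent.symm, ?_⟩
  rw [measure_congr hevent, ← Measure.map_apply_of_aemeasurable hT.aemeasurable measurableSet_Icc,
    hT.map_eq, CohenD.noncentralT_Icc hm, ha, hb]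
  congr 1
  ring
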